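/- An \emph{influence instance} $\mathcal I=(V,E,P_{\mathcal I})$ consists of a finite node set $V$, a set $E\subseteq V\times V$ of directed edges, and a profile $P_{\mathcal I}:2^V\times 2^V\to[0,1]$, where $P_{\mathcal I}(S,T)$ is the probability that seed set $S$ activates exactly $T$; thus $\sum_{T\subseteq V}P_{\mathcal I}(S,T)=1$ for every $S$, $P_{\mathcal I}(\emptyset,\emptyset)=1$, and $P_{\mathcal I}(S,T)=0$ unless $S\subseteq T$. Its influence spread is $\sigma_{\mathcal I}(S)=\sum_{T\supseteq S}P_{\mathcal I}(S,T)\,|T|$. An (influence-based) \emph{centrality measure} $\psi$ assigns to every influence instance a vector $(\psi_v(\mathcal I))_{v\in V}\in\mathbb R^{V}$ as a function of the node set and the influence profile $P_{\mathcal I}$. The \emph{Shapley centrality} is $$\psi^{\mathrm{Shapley}}_v(\mathcal I)=\sum_{S\subseteq V\setminus\{v\}}\frac{|S|!\,(|V|-|S|-1)!}{|V|!}\bigl(\sigma_{\mathcal I}(S\cup\{v\})-\sigma_{\mathcal I}(S)\bigr).$$ A node $v$ is a \emph{sink node} of $\mathcal I$ if $P_{\mathcal I}(S\cup\{v\},T\cup\{v\})=P_{\mathcal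 I}(S,T)+P_{\mathcal I}(S,T\cup\{v\})$ for all $S,T\subseteq V\setminus\{v\}$. The projected instance $\mathcal I\setminus\{v\}$ has node set $V\setminus\{v\}$, the edges of $E$ not incident to $v$, and profile $P_{\mathcal I\setminus\{v\}}(S,T)=P_{\mathcal I}(S,T)+P_{\mathcal I}(S,T\cup\{v\})$. For a nonempty set $R$ and a node $v\notin R$, a \emph{critical set instance} $\mathcal I_{R,v}$ is an instance with node set $V=R\cup\{v\}$ whose network contains all edges from $R$ to $v$, and with $P(S,V)=1$ for $S\supseteq R$ and $P(S,S)=1$ for $S\not\supseteq R$. Consider the following five axioms on a centrality measure $\psi$. (1) \emph{Anonymity}: $\psi_v(\mathcal I)=\psi_{\pi(v)}(\pi(\mathcal I))$ for every instance $\mathcal I$, every permutation $\pi$ of $V$ and every $v\in V$, where $\pi(\mathcal I)$ is the instance on $V$ with edge set $\{(\pi(x),\pi(y)):(x,y)\in E\}$ and $P_{\pi(\mathcal I)}(\pi(S),\pi(T))=P_{\mathcal I}(S,T)$. (2) \emph{Normalization}: $\sum_{v\in V}\psi_v(\mathcal I)=|V|$ for every instance $\mathcal I$. (3) \emph{Independence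 of Sink Nodes}: $\psi_u(\mathcal I)=\psi_u(\mathcal I\setminus\{v\})$ for every instance $\mathcal I$ and any two distinct sink nodes $u,v$ of $\mathcal I$. (4) \emph{Bayesian Influence}: for instances $\mathcal I^1,\dots,\mathcal I^r$ on the same network $(V,E)$ and $\lambda_1,\dots,\lambda_r\ge 0$ with $\sum_\eta\lambda_\eta=1$, the instance $\mathcal I$ on $(V,E)$ with profile $\sum_\eta\lambda_\eta P_{\mathcal I^\eta}$ satisfies $\psi_v(\mathcal I)=\sum_\eta\lambda_\eta\psi_v(\mathcal I^\eta)$ for all $v\in V$. (5) \emph{Bargaining with Critical Sets}: $\psi_v(\mathcal I_{R,v})=\frac{|R|}{|R|+1}$ for every critical set instance $\mathcal I_{R,v}$. \textbf{Theorem.} A centrality measure satisfies all five axioms if and only if it is the Shapley centrality $\psi^{\mathrm{Shapley}}$. Moreover, each axiom is independent of the other four: for each of the five axioms there is a centrality measure that satisfies the other four axioms but not that one. -/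

import Mathlib

universe u

/-- A social-influence instance `(V, E, P)`: a directed network `(V, E)` and a progressive
influence profile; `P S T` is the probability that the seed set `S` activates exactly `T`. -/
structure InfluenceInstance (V : Type u) [Fintype V] [DecidableEq V] where
  E : Set (V × V)
  P : Finset V → Finset V → ℝ
  nonneg : ∀ S T, 0 ≤ P S T
  sum_eq_one : ∀ S, ∑ T, P S T = 1
  empty_empty : P ∅ ∅ = 1
  empty_of_ne : ∀ T, T ≠ ∅ → P ∅ T = 0
  eq_zero_of_not_subset : ∀ S T, ¬ S ⊆ T → P S T = 0

namespace InfluenceInstance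

variable {V : Type u} [Fintype V] [DecidableEq V]

/-- The influence spread: the expected number of nodes activated by the seed set `S`. -/
def spread (I : InfluenceInstance V) (S : Finset V) : ℝ :=
  ∑ T ∈ Finset.univ.filter (fun T => S ⊆ T), I.P S T * (T.card : ℝ)

/-- The isomorphic instance `π(I)`; by `permute_P` and `permute_E` below it satisfies
`P_{π(I)}(π(S), π(T)) = P_I(S, T)` and `(π(u), π(v)) ∈ π(E) ↔ (u, v) ∈ E`. -/
def permute (π : Equiv.Perm V) (I : InfluenceInstance V) : InfluenceInstance V where
  E := {p | (π.symm p.1, π.symm p.2) ∈ I.E}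
  P := fun S T => I.P (S.map π.symm.toEmbedding) (T.map π.symm.toEmbedding)
  nonneg := fun _ _ => I.nonneg _ _
  sum_eq_one := fun S => by
    rw [← I.sum_eq_one (S.map π.symm.toEmbedding)]
    exact (Equiv.finsetCongr π.symm).sum_comp (fun T => I.P (S.map π.symm.toEmbedding) T)
  empty_empty := by simpa using I.empty_empty
  empty_of_ne := fun T hT => by
    rw [Finset.map_empty]
    exact I.empty_of_ne _ (by simpa using hT)
  eq_zero_of_not_subset := fun S T h => I.eq_zero_of_not_subset _ _ (by simpa using h)

theorem permute_P (π : Equiv.Perm V) (I : InfluenceInstance V) (S T : Finset V) :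
    (I.permute π).P (S.map π.toEmbedding) (T.map π.toEmbedding) = I.P S T := by
  simp [permute, Finset.map_map]

theorem permute_E (π : Equiv.Perm V) (I : InfluenceInstance V) (x y : V) :
    (π x, π y) ∈ (I.permute π).E ↔ (x, y) ∈ I.E := by
  simp [permute]

/-- `v` is a sink node: for all `S, T ⊆ V \ {v}`,
`P(S ∪ {v}, T ∪ {v}) = P(S, T) + P(S, T ∪ {v})`. -/
def IsSink (I : InfluenceInstance V) (v : V) : Prop :=
  ∀ S T : Finset V, v ∉ S → v ∉ T →
    I.P (insert v S) (insert v T) = I.P S T + I.P S (insert v T)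

/-- A set of nodes of `V \ {v}`, seen as a set of nodes of `V`. -/
def lift {v : V} (S : Finset {x : V // x ≠ v}) : Finset V :=
  S.map (Function.Embedding.subtype _)

theorem not_mem_lift {W : Type u} {v : W} (S : Finset {x : W // x ≠ v}) : v ∉ lift S := by
  simp [lift]

theorem sum_lift (v : V) (f : Finset V → ℝ) :
    ∑ T : Finset {x : V // x ≠ v}, (f (lift T) + f (insert v (lift T))) = ∑ T, f T := by
  have h1 : (Finset.univ : Finset (Finset V))
      = (insert v (Finset.univ.erase v)).powerset := by simp
  have h2 : (Finset.univ.erase v).powerset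
      = (Finset.univ : Finset (Finset {x : V // x ≠ v})).map
          ⟨lift, Finset.map_injective _⟩ := by
    ext T
    simp only [Finset.mem_powerset, Finset.mem_map, Finset.mem_univ, true_and]
    constructor
    · intro hT
      refine ⟨T.subtype (fun x => x ≠ v), ?_⟩
      ext x
      change x ∈ (T.subtype (fun x => x ≠ v)).map (Function.Embedding.subtype _) ↔ x ∈ T
      rw [Finset.subtype_map, Finset.mem_filter]
      exact ⟨fun h => h.1, fun h => ⟨h, (Finset.mem_erase.1 (hT h)).1⟩⟩
    · rintro ⟨S, rfl⟩ x hx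
      refine Finset.mem_erase.2 ⟨?_, Finset.mem_univ _⟩
      intro hxv
      have hx' : x ∈ lift S := hx
      rw [hxv] at hx'
      exact not_mem_lift S hx'
  rw [h1, Finset.sum_powerset_insert (Finset.notMem_erase v _), h2, Finset.sum_map,
    Finset.sum_map, ← Finset.sum_add_distrib]
  rfl

/-- The projected instance `I \ {v}` on the node set `V \ {v}`. -/
def project (I : InfluenceInstance V) (v : V) : InfluenceInstance {x : V // x ≠ v} where
  E := {p | ((p.1 : V), (p.2 : V)) ∈ I.E}
  P := fun S T => I.P (lift S) (lift T) + I.P (lift S) (insert v (lift T))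
  nonneg := fun _ _ => add_nonneg (I.nonneg _ _) (I.nonneg _ _)
  sum_eq_one := fun S => by
    rw [sum_lift v (fun T => I.P (lift S) T)]
    exact I.sum_eq_one _
  empty_empty := by
    have h := I.empty_of_ne {v} (Finset.singleton_ne_empty v)
    simp [lift, I.empty_empty, h]
  empty_of_ne := fun T hT => by
    have h1 : I.P ∅ (lift T) = 0 := I.empty_of_ne _ (by simpa [lift] using hT)
    have h2 : I.P ∅ (insert v (lift T)) = 0 := I.empty_of_ne _ (Finset.insert_ne_empty _ _)
    have h3 : lift (∅ : Finset {x : V // x ≠ v}) = ∅ := by simp [lift]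
    rw [h3, h1, h2, add_zero]
  eq_zero_of_not_subset := fun S T h => by
    have h1 : ¬ lift S ⊆ lift T := by simpa [lift] using h
    have h2 : ¬ lift S ⊆ insert v (lift T) := fun hs =>
      h1 ((Finset.subset_insert_iff_of_notMem (not_mem_lift S)).1 hs)
    rw [I.eq_zero_of_not_subset _ _ h1, I.eq_zero_of_not_subset _ _ h2, add_zero]

/-- The Bayesian influence instance on the network `(V, E)`: the instance `I η` is drawn with
probability `lam η`. (It is applied to instances `I η` that all live on the network `(V, E)`.) -/
def bayes (E : Set (V × V)) {r : ℕ} (I : Fin r → InfluenceInstance V) (lam : Fin r → ℝ)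
    (hnonneg : ∀ η, 0 ≤ lam η) (hsum : ∑ η, lam η = 1) : InfluenceInstance V where
  E := E
  P := fun S T => ∑ η, lam η * (I η).P S T
  nonneg := fun S T => Finset.sum_nonneg fun η _ => mul_nonneg (hnonneg η) ((I η).nonneg S T)
  sum_eq_one := fun S => by
    rw [Finset.sum_comm, ← hsum]
    refine Finset.sum_congr rfl fun η _ => ?_
    rw [← Finset.mul_sum, (I η).sum_eq_one, mul_one]
  empty_empty := by
    rw [← hsum]
    exact Finset.sum_congr rfl fun η _ => by rw [(I η).empty_empty, mul_one]
  empty_of_ne := fun T hT =>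
    Finset.sum_eq_zero fun η _ => by rw [(I η).empty_of_ne T hT, mul_zero]
  eq_zero_of_not_subset := fun S T h =>
    Finset.sum_eq_zero fun η _ => by rw [(I η).eq_zero_of_not_subset S T h, mul_zero]

/-- `I` is a critical set instance with critical set `R` and target set `U`: the network contains
all edges from `R` to `U \ R`, the nodes outside `U` are isolated in the network, a seed set
containing `R` activates all of `U` (and nothing else besides itself), and any other seed set
activates only itself. -/
structure IsCriticalSet (I : InfluenceInstance V) (R U : Finset V) : Prop where
  nonempty : R.Nonempty
  subset : R ⊆ U
  bipartite : ∀ x ∈ R, ∀ y ∈ U \ R, (x, y) ∈ I.E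
  isolated : ∀ x ∉ U, ∀ y, (x, y) ∉ I.E ∧ (y, x) ∉ I.E
  activates : ∀ S, R ⊆ S → I.P S (U ∪ S) = 1
  inert : ∀ S, ¬ R ⊆ S → I.P S S = 1

end InfluenceInstance

/-- The Shapley value of node `v` in the coalitional game with characteristic function `τ`. -/
noncomputable def shapleyValue {V : Type u} [Fintype V] [DecidableEq V]
    (τ : Finset V → ℝ) (v : V) : ℝ :=
  ∑ S ∈ (Finset.univ.erase v).powerset,
    ((Nat.factorial S.card : ℝ) * (Nat.factorial (Fintype.card V - S.card - 1) : ℝ)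
        / (Nat.factorial (Fintype.card V) : ℝ)) * (τ (insert v S) - τ S)

/-- An influence-based centrality measure: it assigns a real vector indexed by the nodes to every
influence instance on every finite node set, as a function of the influence profile. -/
@[ext]
structure CentralityMeasure where
  val : ∀ (V : Type u) [Fintype V] [DecidableEq V], InfluenceInstance V → V → ℝ
  of_profile : ∀ (V : Type u) [Fintype V] [DecidableEq V] (I J : InfluenceInstance V),
    I.P = J.P → val V I = val V J

/-- The Shapley centrality: the Shapley value of the influence spread function. -/
noncomputable def shapleyCentrality : CentralityMeasure.{u} where
  val := fun _ _ _ I v => shapleyValue I.spread v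
  of_profile := fun V _ _ I J h => by
    have hs : I.spread = J.spread := by
      funext S
      simp only [InfluenceInstance.spread, h]
    rw [hs]

namespace CentralityMeasure

/-- Anonymity: `ψ_v(I) = ψ_{π(v)}(π(I))`. -/
def Anonymity (ψ : CentralityMeasure.{u}) : Prop :=
  ∀ (V : Type u) [Fintype V] [DecidableEq V] (I : InfluenceInstance V) (π : Equiv.Perm V) (v : V),
    ψ.val V I v = ψ.val V (I.permute π) (π v)

/-- Normalization: the centralities of all nodes add up to `|V|`. -/
def Normalization (ψ : CentralityMeasure.{u}) : Prop :=
  ∀ (V : Type u) [Fintype V] [DecidableEq V] (I : InfluenceInstance V),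
    ∑ v, ψ.val V I v = (Fintype.card V : ℝ)

/-- Independence of Sink Nodes: for two sink nodes `x ≠ v`, `ψ_x(I) = ψ_x(I \ {v})`. -/
def IndependenceOfSinkNodes (ψ : CentralityMeasure.{u}) : Prop :=
  ∀ (V : Type u) [Fintype V] [DecidableEq V] (I : InfluenceInstance V) (x v : V) (hxv : x ≠ v),
    I.IsSink x → I.IsSink v → ψ.val V I x = ψ.val {y : V // y ≠ v} (I.project v) ⟨x, hxv⟩

/-- Bayesian Influence: the centrality of a Bayesian instance is the expected centrality. -/
def BayesianInfluence (ψ : CentralityMeasure.{u}) : Prop :=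
  ∀ (V : Type u) [Fintype V] [DecidableEq V] (E : Set (V × V)) (r : ℕ)
    (I : Fin r → InfluenceInstance V) (lam : Fin r → ℝ)
    (hnonneg : ∀ η, 0 ≤ lam η) (hsum : ∑ η, lam η = 1), (∀ η, (I η).E = E) →
    ∀ v : V, ψ.val V (InfluenceInstance.bayes E I lam hnonneg hsum) v
      = ∑ η, lam η * ψ.val V (I η) v

/-- Bargaining with Critical Sets: in the critical set instance `I_{R,v}`, whose node set and
target set are both `R ∪ {v}` with `v ∉ R`, the centrality of `v` is `|R| / (|R| + 1)`. -/
def BargainingWithCriticalSets (ψ : CentralityMeasure.{u}) : Prop :=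
  ∀ (V : Type u) [Fintype V] [DecidableEq V] (I : InfluenceInstance V) (R : Finset V) (v : V),
    v ∉ R → insert v R = Finset.univ → I.IsCriticalSet R (insert v R) →
    ψ.val V I v = (R.card : ℝ) / ((R.card : ℝ) + 1)

end CentralityMeasure

/-!
**The axioms determine the Shapley centrality.** A centrality measure depends only on the profile,
and Bayesian Influence makes it affine in the profile. Hence it is determined by its values on the
instance without influence and on the instances that respond to a single seed set
(`BayesianInfluence.expansion`), and those are obtained from the critical set instances, on a node
set that may be larger than the target set, by downward induction on the seed set
(`BayesianInfluence.ext_of_critical`). In a critical set instance all nodes outside the critical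
set `R` are sinks; projecting away all of them but one, `x`, leaves `R ∪ {x}`, where `x` is either
in the target set, so that Bargaining applies, or there is no influence at all
(`val_critical_of_notMem`). The nodes of `R` are exchangeable, so Anonymity and Normalization do
the rest (`val_critical_of_mem`).

**The Shapley centrality satisfies the axioms.** Normalization is the efficiency of the Shapley
value (`sum_shapleyValue`). For the axioms about sinks, the marginal contribution of a sink `x` to
the seed set `S` is the probability that `S` does not activate `x` (`IsSink.marginal`), which is
unchanged when another sink is seeded or deleted.

**Independence of the axioms.** Four of the five examples add a perturbation `c` to the Shapley
centrality. If `c` vanishes at sinks, then Independence of Sink Nodes and Bargaining survive; if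
its values have sum `0`, Normalization does. The perturbations are a transfer between two chosen
nodes, an unbalanced bonus, one that is scaled depending on the number of nodes, and one that is
nonlinear in the profile. The remaining example is the constant centrality `1`.
-/

open Finset InfluenceInstance

namespace InfluenceInstance

/-! ### Expectations over the activated set, sinks and projections -/

theorem mem_lift {V : Type u} {v x : V} {S : Finset {y : V // y ≠ v}} :
    x ∈ lift S ↔ ∃ h : x ≠ v, (⟨x, h⟩ : {y : V // y ≠ v}) ∈ S := by
  simp [lift]

theorem card_lift {V : Type u} {v : V} (S : Finset {y : V // y ≠ v}) : (lift S).card = S.card :=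
  card_map _

theorem lift_insert {V : Type u} [DecidableEq V] {v x : V} (h : x ≠ v)
    (S : Finset {y : V // y ≠ v}) :
    lift (insert ⟨x, h⟩ S) = insert x (lift S) := by
  simp [lift, map_insert]

theorem lift_injective {V : Type u} {v : V} :
    Function.Injective (lift : Finset {y : V // y ≠ v} → Finset V) :=
  map_injective _

variable {V : Type u} [Fintype V] [DecidableEq V]

theorem spread_eq_sum (I : InfluenceInstance V) (S : Finset V) :
    I.spread S = ∑ T, I.P S T * (T.card : ℝ) := by
  rw [spread, sum_filter]
  refine sum_congr rfl fun T _ => ?_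
  split_ifs with h
  · rfl
  · rw [I.eq_zero_of_not_subset S T h, zero_mul]

/-- Adding a sink `v` to the seed set adds `v` to the activated set and changes nothing else. -/
theorem IsSink.sum_insert {I : InfluenceInstance V} {v : V} (h : I.IsSink v) {S : Finset V}
    (hS : v ∉ S) (g : Finset V → ℝ) :
    ∑ T, I.P (insert v S) T * g T = ∑ T, I.P S T * g (insert v T) := by
  rw [← sum_lift v, ← sum_lift v (fun T => I.P S T * g (insert v T))]
  refine sum_congr rfl fun T _ => ?_
  have h0 : I.P (insert v S) (lift T) = 0 :=
    I.eq_zero_of_not_subset _ _ fun hs => not_mem_lift T (hs (mem_insert_self _ _))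
  rw [h0, h S (lift T) hS (not_mem_lift T), insert_idem]
  ring

theorem sum_project (I : InfluenceInstance V) (v : V) (S : Finset {y : V // y ≠ v})
    (g : Finset V → ℝ) :
    ∑ T, (I.project v).P S T * g (lift T) = ∑ T, I.P (lift S) T * g (T.erase v) := by
  rw [← sum_lift v (fun T => I.P (lift S) T * g (T.erase v))]
  refine sum_congr rfl fun T _ => ?_
  simp [project, not_mem_lift, add_mul]

theorem IsSink.project {I : InfluenceInstance V} {x v : V} (h : I.IsSink x) (hxv : x ≠ v) :
    (I.project v).IsSink ⟨x, hxv⟩ := by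
  intro S T hS hT
  have hS' : x ∉ lift S := by simpa [mem_lift, hxv] using hS
  have hT' : x ∉ lift T := by simpa [mem_lift, hxv] using hT
  have hT'' : x ∉ insert v (lift T) := by simp [hxv, hT']
  simp only [InfluenceInstance.project, lift_insert]
  rw [insert_comm v x, h _ _ hS' hT', h _ _ hS' hT'']
  ring

/-- The marginal contribution of a sink `x` to the spread is the probability that `x` is not
activated without being a seed. -/
theorem IsSink.marginal {I : InfluenceInstance V} {x : V} (h : I.IsSink x) {S : Finset V}
    (hS : x ∉ S) :
    I.spread (insert x S) - I.spread S = ∑ T, I.P S T * (if x ∈ T then 0 else 1) := by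
  rw [spread_eq_sum, spread_eq_sum, h.sum_insert hS, ← sum_sub_distrib]
  refine sum_congr rfl fun T _ => ?_
  split_ifs with hx
  · rw [insert_eq_of_mem hx]; ring
  · rw [card_insert_of_notMem hx]; push_cast; ring

theorem IsSink.spread_singleton {I : InfluenceInstance V} {x : V} (h : I.IsSink x) :
    I.spread {x} = 1 := by
  have h1 := h.sum_insert (notMem_empty x) (fun T => (T.card : ℝ))
  rw [spread_eq_sum]
  change ∑ T, I.P (insert x ∅) T * (T.card : ℝ) = 1
  rw [h1, sum_eq_single ∅]
  · simp [I.empty_empty]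
  · intro T _ hT
    rw [I.empty_of_ne T hT, zero_mul]
  · simp

theorem sum_bayes (E : Set (V × V)) {r : ℕ} (I : Fin r → InfluenceInstance V) (lam : Fin r → ℝ)
    (hnonneg : ∀ η, 0 ≤ lam η) (hsum : ∑ η, lam η = 1) (S : Finset V) (g : Finset V → ℝ) :
    ∑ T, (bayes E I lam hnonneg hsum).P S T * g T = ∑ η, lam η * ∑ T, (I η).P S T * g T := by
  simp only [bayes, sum_mul, mul_sum, mul_assoc]
  exact sum_comm

theorem sum_permute (π : Equiv.Perm V) (I : InfluenceInstance V) (S : Finset V)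
    (g : Finset V → ℝ) :
    ∑ T, (I.permute π).P (S.map π.toEmbedding) T * g T
      = ∑ T, I.P S T * g (T.map π.toEmbedding) := by
  rw [← (Equiv.finsetCongr π).sum_comp]
  refine sum_congr rfl fun T _ => ?_
  rw [Equiv.finsetCongr_apply, permute_P]

theorem spread_permute (π : Equiv.Perm V) (I : InfluenceInstance V) (S : Finset V) :
    (I.permute π).spread (S.map π.toEmbedding) = I.spread S := by
  simp only [spread_eq_sum, sum_permute, card_map]

theorem permute_P_singleton_univ (π : Equiv.Perm V) (I : InfluenceInstance V) (v : V) :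
    (I.permute π).P {π v} univ = I.P {v} univ := by
  have := permute_P π I {v} univ
  rwa [map_singleton, map_univ_equiv] at this

/-- Certain activation of one set excludes all others. -/
theorem P_eq_ite (I : InfluenceInstance V) {S T₀ : Finset V} (h : I.P S T₀ = 1) (T : Finset V) :
    I.P S T = if T = T₀ then 1 else 0 := by
  split_ifs with hT
  · rw [hT, h]
  · have h1 := I.sum_eq_one S
    rw [← add_sum_erase _ _ (mem_univ T₀), h] at h1
    have h2 : ∑ T ∈ univ.erase T₀, I.P S T = 0 := by linarith
    exact (sum_eq_zero_iff_of_nonneg fun T _ => I.nonneg S T).1 h2 T (by simp [hT])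

/-! ### Trigger instances -/

/-- The set activated by the seed set `X` when the nonempty seed sets with property `p`, and only
those, activate all of `U` in addition to themselves. -/
def triggered (p : Finset V → Prop) [DecidablePred p] (U X : Finset V) : Finset V :=
  if X.Nonempty ∧ p X then X ∪ U else X

/-- The deterministic instance in which exactly the nonempty seed sets with property `p` activate
`U` on top of themselves. Taking `p X` to be `R ⊆ X` gives a critical set instance, `X = R` an
instance that responds to a single seed set, and `False` the instance without influence. The
network is complete, which makes no difference to a centrality measure. -/
def trigger (p : Finset V → Prop) [DecidablePred p] (U : Finset V) : InfluenceInstance V where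
  E := Set.univ
  P := fun S T => if T = triggered p U S then 1 else 0
  nonneg := fun S T => by split_ifs <;> norm_num
  sum_eq_one := fun S => by simp
  empty_empty := by simp [triggered]
  empty_of_ne := fun T hT => by simp [triggered, hT]
  eq_zero_of_not_subset := fun S T h => by
    rw [if_neg]
    rintro rfl
    apply h
    rw [triggered]
    split_ifs
    · exact subset_union_left
    · exact Subset.rfl

variable {p : Finset V → Prop} [DecidablePred p] {U : Finset V}

theorem trigger_P (S T : Finset V) :
    (trigger p U).P S T = if T = triggered p U S then 1 else 0 := rfl

omit [Fintype V] in
theorem triggered_of_pos {R S : Finset V} (hR : R.Nonempty) (h : R ⊆ S) :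
    triggered (R ⊆ ·) U S = S ∪ U :=
  if_pos ⟨hR.mono h, h⟩

omit [Fintype V] in
theorem triggered_of_neg {R S : Finset V} (h : ¬ R ⊆ S) : triggered (R ⊆ ·) U S = S :=
  if_neg fun h' => h h'.2

theorem sum_trigger (S : Finset V) (g : Finset V → ℝ) :
    ∑ T, (trigger p U).P S T * g T = g (triggered p U S) := by
  simp [trigger_P]

theorem trigger_P_congr {q : Finset V → Prop} [DecidablePred q] {W : Finset V}
    (h : ∀ X, X.Nonempty → triggered p U X = triggered q W X) :
    (trigger p U).P = (trigger q W).P := by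
  funext S T
  rcases S.eq_empty_or_nonempty with rfl | hS
  · simp [trigger_P, triggered]
  · rw [trigger_P, trigger_P, h S hS]

theorem trigger_permute (π : Equiv.Perm V)
    (hp : ∀ X, p (X.map π.toEmbedding) ↔ p X) (hU : U.map π.toEmbedding = U) :
    ((trigger p U).permute π).P = (trigger p U).P := by
  have key : ∀ X : Finset V, triggered p U (X.map π.toEmbedding)
      = (triggered p U X).map π.toEmbedding := by
    intro X
    simp only [triggered, map_nonempty, hp]
    split_ifs
    · rw [map_union, hU]
    · rfl
  funext S T
  obtain ⟨S, rfl⟩ := (Equiv.finsetCongr π).surjective S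
  obtain ⟨T, rfl⟩ := (Equiv.finsetCongr π).surjective T
  rw [Equiv.finsetCongr_apply, Equiv.finsetCongr_apply, permute_P, trigger_P, trigger_P, key]
  simp only [map_inj]

theorem trigger_isSink {R : Finset V} (hR : R.Nonempty) {v : V} (hv : v ∉ R) :
    (trigger (R ⊆ ·) U).IsSink v := by
  intro S T hS hT
  have h : triggered (R ⊆ ·) U (insert v S) = insert v (triggered (R ⊆ ·) U S) := by
    simp only [triggered, subset_insert_iff_of_notMem hv]
    by_cases hRS : R ⊆ S
    · simp [hRS, hR.mono hRS, insert_union]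
    · simp [hRS]
  simp only [trigger_P, h]
  by_cases hvS : v ∈ triggered (R ⊆ ·) U S
  · rw [insert_eq_of_mem hvS, if_neg (fun hT' : T = _ => hT (hT' ▸ hvS)), zero_add]
  · rw [if_neg (fun h' : insert v T = triggered (R ⊆ ·) U S => hvS (h' ▸ mem_insert_self v T)),
      add_zero]
    congr 1
    refine propext ⟨fun h' => ?_, fun h' => by rw [h']⟩
    rw [← erase_insert hT, h', erase_insert hvS]

omit [Fintype V] in
theorem lift_subtype_subset {R : Finset V} {v : V} (hv : v ∉ R) (S : Finset {y : V // y ≠ v}) :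
    R.subtype (· ≠ v) ⊆ S ↔ R ⊆ lift S := by
  constructor
  · intro h x hx
    have hxv : x ≠ v := fun h' => hv (h' ▸ hx)
    exact mem_lift.2 ⟨hxv, h (by simpa using hx)⟩
  · intro h x hx
    obtain ⟨_, hx'⟩ := mem_lift.1 (h (mem_subtype.1 hx))
    exact hx'

theorem trigger_project {R : Finset V} (hR : R.Nonempty) {v : V} (hv : v ∉ R) :
    ((trigger (R ⊆ ·) U).project v).P
      = (trigger (R.subtype (· ≠ v) ⊆ ·) (U.subtype (· ≠ v))).P := by
  funext S T
  have key : lift (triggered (R.subtype (· ≠ v) ⊆ ·) (U.subtype (· ≠ v)) S)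
      = (triggered (R ⊆ ·) U (lift S)).erase v := by
    simp only [triggered, lift_subtype_subset hv]
    ext x
    by_cases hRS : R ⊆ lift S
    · have h1 : (lift S).Nonempty := hR.mono hRS
      have h2 : S.Nonempty := by simpa [lift] using h1
      by_cases hx : x = v <;> simp [hRS, h1, h2, hx, mem_lift]
    · by_cases hx : x = v <;> simp [hRS, hx, mem_lift]
  rw [trigger_P]
  simp only [project, trigger_P]
  generalize triggered (R.subtype (· ≠ v) ⊆ ·) (U.subtype (· ≠ v)) S = A at key
  generalize triggered (R ⊆ ·) U (lift S) = B at key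
  have hT := not_mem_lift T
  by_cases hB : v ∈ B
  · rw [if_neg (fun h' : lift T = B => hT (h' ▸ hB)), zero_add]
    congr 1
    refine propext ⟨fun h' => lift_injective ?_, fun h' => ?_⟩
    · rw [key, ← h', erase_insert hT]
    · rw [h', key, insert_erase hB]
  · rw [if_neg (fun h' : insert v (lift T) = B => hB (h' ▸ mem_insert_self _ _)), add_zero]
    rw [erase_eq_of_notMem hB] at key
    congr 1
    rw [← key]
    exact propext lift_injective.eq_iff

theorem IsCriticalSet.P_eq {I : InfluenceInstance V} {R : Finset V} (h : I.IsCriticalSet R U) :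
    I.P = (trigger (R ⊆ ·) U).P := by
  funext S T
  rw [trigger_P]
  by_cases hRS : R ⊆ S
  · rw [I.P_eq_ite (h.activates S hRS), triggered_of_pos h.nonempty hRS, union_comm]
  · rw [I.P_eq_ite (h.inert S hRS), triggered_of_neg hRS]

theorem isSink_congr {I J : InfluenceInstance V} (h : I.P = J.P) {v : V} (hv : I.IsSink v) :
    J.IsSink v := by
  intro S T hS hT
  rw [← h]
  exact hv S T hS hT

theorem trigger_isCriticalSet {R : Finset V} (hR : R.Nonempty) {v : V}
    (huniv : insert v R = univ) :
    (trigger (R ⊆ ·) (insert v R)).IsCriticalSet R (insert v R) where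
  nonempty := hR
  subset := subset_insert _ _
  bipartite := fun _ _ _ _ => trivial
  isolated := fun x hx => absurd (huniv ▸ mem_univ x) hx
  activates := fun S hS => by
    rw [trigger_P, triggered_of_pos hR hS, union_comm, if_pos rfl]
  inert := fun S hS => by
    rw [trigger_P, triggered_of_neg hS, if_pos rfl]

end InfluenceInstance

/-! ### The Shapley value -/

section ShapleyValue

/-- The probability that the predecessors of a fixed node in a uniformly random order of `n` nodes
form a given set of `s` nodes. -/
noncomputable def shapleyWeight (n s : ℕ) : ℝ :=
  (Nat.factorial s : ℝ) * (Nat.factorial (n - s - 1) : ℝ) / (Nat.factorial n : ℝ)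

theorem shapleyWeight_add {n s : ℕ} (h : s + 1 ≤ n) :
    shapleyWeight (n + 1) s + shapleyWeight (n + 1) (s + 1) = shapleyWeight n s := by
  obtain ⟨k, rfl⟩ := Nat.exists_eq_add_of_le h
  have e1 : s + 1 + k + 1 - s - 1 = k + 1 := by omega
  have e2 : s + 1 + k + 1 - (s + 1) - 1 = k := by omega
  have e3 : s + 1 + k - s - 1 = k := by omega
  have h0 : (Nat.factorial (s + 1 + k) : ℝ) ≠ 0 := by positivity
  simp only [shapleyWeight, e1, e2, e3, Nat.factorial_succ (s + 1 + k), Nat.factorial_succ k,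
    Nat.factorial_succ s]
  push_cast
  field_simp
  ring

/-- The total weight of a set in the sum of all Shapley values vanishes unless the set is empty or
everything. -/
theorem mul_shapleyWeight_eq {n s : ℕ} (h0 : s ≠ 0) (hn : s < n) :
    (s : ℝ) * shapleyWeight n (s - 1) = ((n : ℝ) - s) * shapleyWeight n s := by
  obtain ⟨t, rfl⟩ := Nat.exists_eq_add_one_of_ne_zero h0
  obtain ⟨k, rfl⟩ := Nat.exists_eq_add_of_lt hn
  have e1 : t + 1 + k + 1 - t - 1 = k + 1 := by omega
  have e2 : t + 1 + k + 1 - (t + 1) - 1 = k := by omega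
  simp only [shapleyWeight, Nat.add_sub_cancel, e1, e2, Nat.factorial_succ t,
    Nat.factorial_succ k]
  push_cast
  ring

theorem shapleyWeight_self (k : ℕ) : shapleyWeight (k + 1) k = 1 / ((k : ℝ) + 1) := by
  have : (Nat.factorial k : ℝ) ≠ 0 := by positivity
  have e : k + 1 - k - 1 = 0 := by omega
  simp only [shapleyWeight, e, Nat.factorial_succ, Nat.factorial_zero]
  push_cast
  field_simp

theorem shapleyWeight_zero (k : ℕ) : shapleyWeight (k + 1) 0 = 1 / ((k : ℝ) + 1) := by
  have : (Nat.factorial k : ℝ) ≠ 0 := by positivity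
  simp only [shapleyWeight, Nat.sub_zero, Nat.add_sub_cancel, Nat.factorial_succ,
    Nat.factorial_zero]
  push_cast
  field_simp

variable {V : Type u} [Fintype V] [DecidableEq V]

theorem shapleyValue_eq_sum_ite (τ : Finset V → ℝ) (v : V) :
    shapleyValue τ v = ∑ S : Finset V,
      if v ∈ S then 0 else shapleyWeight (Fintype.card V) S.card * (τ (insert v S) - τ S) := by
  have h : (univ.erase v).powerset = univ.filter (fun S : Finset V => v ∉ S) := by
    ext S
    simp [subset_erase]
  rw [shapleyValue, h, sum_filter]
  refine sum_congr rfl fun S _ => ?_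
  by_cases hv : v ∈ S <;> simp [hv, shapleyWeight]

theorem shapleyValue_map (π : Equiv.Perm V) {τ τ' : Finset V → ℝ}
    (h : ∀ S, τ' (S.map π.toEmbedding) = τ S) (v : V) :
    shapleyValue τ' (π v) = shapleyValue τ v := by
  rw [shapleyValue_eq_sum_ite, shapleyValue_eq_sum_ite, ← (Equiv.finsetCongr π).sum_comp]
  refine sum_congr rfl fun S _ => ?_
  have h1 : insert (π v) (S.map π.toEmbedding) = (insert v S).map π.toEmbedding := by
    simp [map_insert]
  rw [Equiv.finsetCongr_apply, h1, h, h, card_map]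
  simp

/-- Efficiency: the Shapley values share out the worth of the grand coalition. -/
theorem sum_shapleyValue (τ : Finset V → ℝ) : ∑ v, shapleyValue τ v = τ univ - τ ∅ := by
  set n := Fintype.card V with hn
  -- Collect, for each `v`, the terms with `insert v S = T` at the set `T`.
  have h1 : ∀ v : V, shapleyValue τ v = ∑ T : Finset V,
      ((if v ∈ T then shapleyWeight n (T.card - 1) * τ T else 0)
        - (if v ∉ T then shapleyWeight n T.card * τ T else 0)) := by
    intro v
    rw [shapleyValue_eq_sum_ite, ← sum_lift v, ← sum_lift v]
    refine sum_congr rfl fun S _ => ?_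
    have hv := not_mem_lift S
    simp only [hv, mem_insert_self, if_true, if_false, not_true_eq_false, not_false_eq_true,
      card_insert_of_notMem hv, Nat.add_sub_cancel]
    ring
  simp only [h1]
  rw [sum_comm]
  have h2 : ∀ T : Finset V, ∑ v, ((if v ∈ T then shapleyWeight n (T.card - 1) * τ T else 0)
        - (if v ∉ T then shapleyWeight n T.card * τ T else 0))
      = (if T = univ then τ T else 0) - (if T = ∅ then τ T else 0) := by
    intro T
    have hT : T.card ≤ n := card_le_univ T
    have hc : ((univ.filter (fun v => v ∉ T)).card : ℝ) = n - T.card := by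
      rw [filter_notMem_eq_sdiff, ← compl_eq_univ_sdiff, card_compl, Nat.cast_sub hT]
    rw [sum_sub_distrib, ← sum_filter, ← sum_filter, sum_const, sum_const, nsmul_eq_mul,
      nsmul_eq_mul, hc, filter_mem_eq_inter, univ_inter, ← mul_assoc, ← mul_assoc]
    by_cases hu : T = univ
    · have hTn : T.card = n := by rw [hu, card_univ]
      rw [hTn, sub_self, zero_mul, zero_mul, if_pos hu]
      by_cases he : T = ∅
      · have : n = 0 := by rw [← hTn, he, card_empty]
        simp [he, this]
      · have hpos : n ≠ 0 := by rw [← hTn]; exact fun h => he (card_eq_zero.1 h)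
        obtain ⟨k, hk⟩ := Nat.exists_eq_add_one_of_ne_zero hpos
        have : (n : ℝ) * shapleyWeight n (n - 1) = 1 := by
          rw [hk, Nat.add_sub_cancel, shapleyWeight_self]
          push_cast
          field_simp
        rw [this, if_neg he]
        ring
    · have hlt : T.card < n := by
        rw [hn, ← card_univ]
        exact card_lt_card (T.subset_univ.ssubset_of_ne hu)
      rw [if_neg hu]
      by_cases he : T = ∅
      · subst he
        rw [card_empty] at hlt ⊢
        obtain ⟨k, hk⟩ := Nat.exists_eq_add_one_of_ne_zero hlt.ne'
        have : (n : ℝ) * shapleyWeight n 0 = 1 := by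
          rw [hk, shapleyWeight_zero]
          push_cast
          field_simp
        simp [this]
      · rw [mul_shapleyWeight_eq (fun h => he (card_eq_zero.1 h)) hlt, if_neg he]
        ring
  rw [sum_congr rfl fun T _ => h2 T, sum_sub_distrib]
  simp

/-- The Shapley value at a sink: the marginal contributions are probabilities. -/
theorem shapleyValue_sink {I : InfluenceInstance V} {x : V} (h : I.IsSink x) :
    shapleyValue I.spread x = ∑ S : Finset V, if x ∈ S then 0 else
      shapleyWeight (Fintype.card V) S.card * ∑ T, I.P S T * (if x ∈ T then 0 else 1) := by
  rw [shapleyValue_eq_sum_ite]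
  refine sum_congr rfl fun S _ => ?_
  split_ifs with hx
  · rfl
  · rw [h.marginal hx]

theorem sum_shapleyWeight (v : V) :
    ∑ S : Finset V, (if v ∈ S then 0 else shapleyWeight (Fintype.card V) S.card) = 1 := by
  -- Efficiency for the game `S ↦ 1_{v ∈ S}`, in which only `v` contributes.
  have h := sum_shapleyValue (fun S : Finset V => if v ∈ S then (1 : ℝ) else 0)
  rw [sum_eq_single v] at h
  · rw [shapleyValue_eq_sum_ite] at h
    simp only [mem_insert_self, mem_univ, notMem_empty, if_true, if_false, sub_zero] at h
    rw [← h]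
    refine sum_congr rfl fun S _ => ?_
    split_ifs <;> simp
  · intro w _ hw
    rw [shapleyValue_eq_sum_ite]
    refine sum_eq_zero fun S _ => ?_
    simp [hw.symm]
  · simp

end ShapleyValue

/-! ### The Shapley centrality satisfies the axioms -/

namespace CentralityMeasure

theorem shapley_anonymity : shapleyCentrality.{u}.Anonymity := fun _ _ _ I π v =>
  (shapleyValue_map π (spread_permute π I) v).symm

theorem shapley_normalization : shapleyCentrality.{u}.Normalization := by
  intro V _ _ I
  change ∑ v, shapleyValue I.spread v = _
  rw [sum_shapleyValue, spread_eq_sum, spread_eq_sum]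
  have h1 : ∑ T, I.P univ T * (T.card : ℝ) = ∑ T, I.P univ T * (Fintype.card V : ℝ) := by
    refine sum_congr rfl fun T _ => ?_
    by_cases hT : T = univ
    · rw [hT, card_univ]
    · rw [I.eq_zero_of_not_subset univ T (fun h => hT (univ_subset_iff.1 h)), zero_mul, zero_mul]
  have h2 : ∑ T, I.P ∅ T * (T.card : ℝ) = 0 := by
    refine sum_eq_zero fun T _ => ?_
    by_cases hT : T = ∅
    · rw [hT, card_empty, Nat.cast_zero, mul_zero]
    · rw [I.empty_of_ne T hT, zero_mul]
  rw [h1, h2, ← sum_mul, I.sum_eq_one, one_mul, sub_zero]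

theorem shapley_independenceOfSinkNodes : shapleyCentrality.{u}.IndependenceOfSinkNodes := by
  intro V _ _ I x v hxv hx hv
  change shapleyValue I.spread x = shapleyValue (I.project v).spread ⟨x, hxv⟩
  rw [shapleyValue_sink hx, shapleyValue_sink (hx.project hxv), ← sum_lift v]
  refine sum_congr rfl fun S _ => ?_
  have hcard : Fintype.card V = Fintype.card {y : V // y ≠ v} + 1 := by
    rw [Fintype.card_subtype_compl, Fintype.card_subtype_eq]
    have : 0 < Fintype.card V := Fintype.card_pos_iff.2 ⟨v⟩
    omega
  by_cases hxS : (⟨x, hxv⟩ : {y : V // y ≠ v}) ∈ S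
  · have : x ∈ lift S := mem_lift.2 ⟨hxv, hxS⟩
    simp [hxS, this]
  · have h1 : x ∉ lift S := by simpa [mem_lift, hxv] using hxS
    have h2 : x ∉ insert v (lift S) := by simp [hxv, h1]
    have hlt : S.card + 1 ≤ Fintype.card {y : V // y ≠ v} :=
      card_lt_univ_of_notMem hxS
    -- Neither seeding `v` nor deleting it changes the probability that `x` stays inactive.
    have h3 : ∑ T, I.P (insert v (lift S)) T * (if x ∈ T then (0 : ℝ) else 1)
        = ∑ T, I.P (lift S) T * (if x ∈ T then 0 else 1) := by
      rw [hv.sum_insert (not_mem_lift S)]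
      simp [hxv]
    have h4 : ∑ T, (I.project v).P S T * (if (⟨x, hxv⟩ : {y : V // y ≠ v}) ∈ T then (0 : ℝ) else 1)
        = ∑ T, I.P (lift S) T * (if x ∈ T then 0 else 1) := by
      have := sum_project I v S (fun T => if x ∈ T then (0 : ℝ) else 1)
      simpa [mem_lift, hxv] using this
    rw [if_neg h1, if_neg h2, if_neg hxS, h3, h4, card_insert_of_notMem (not_mem_lift S),
      card_lift, hcard, ← shapleyWeight_add hlt]
    ring

theorem shapley_bayesianInfluence : shapleyCentrality.{u}.BayesianInfluence := by
  intro V _ _ E r I lam hnonneg hsum _ v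
  change shapleyValue (bayes E I lam hnonneg hsum).spread v
    = ∑ η, lam η * shapleyValue (I η).spread v
  have h : ∀ S, (bayes E I lam hnonneg hsum).spread S = ∑ η, lam η * (I η).spread S := by
    intro S
    simp only [spread_eq_sum]
    exact sum_bayes E I lam hnonneg hsum S _
  simp only [shapleyValue, h, mul_sum]
  rw [sum_comm]
  refine sum_congr rfl fun S _ => ?_
  rw [← sum_sub_distrib, mul_sum]
  refine sum_congr rfl fun η _ => ?_
  ring

theorem shapley_bargainingWithCriticalSets :
    shapleyCentrality.{u}.BargainingWithCriticalSets := by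
  intro V _ _ I R v hv huniv hI
  have hR := hI.nonempty
  rw [shapleyCentrality.of_profile V I _ hI.P_eq]
  change shapleyValue (trigger (R ⊆ ·) (insert v R)).spread v = _
  rw [shapleyValue_sink (trigger_isSink hR hv)]
  simp only [sum_trigger]
  -- Among the sets that do not contain `v`, only `R` activates `v`.
  have h1 : ∀ S : Finset V, (if v ∈ S then (0 : ℝ) else shapleyWeight (Fintype.card V) S.card *
        (if v ∈ triggered (R ⊆ ·) (insert v R) S then 0 else 1))
      = (if v ∈ S then 0 else shapleyWeight (Fintype.card V) S.card)
        - (if S = R then shapleyWeight (Fintype.card V) R.card else 0) := by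
    intro S
    by_cases hvS : v ∈ S
    · have : S ≠ R := fun h => hv (h ▸ hvS)
      simp [hvS, this]
    · by_cases hRS : R ⊆ S
      · have hSR : S ⊆ R := by
          have : S ⊆ insert v R := huniv ▸ subset_univ S
          exact (subset_insert_iff_of_notMem hvS).1 this
        obtain rfl : S = R := Subset.antisymm hSR hRS
        simp [triggered_of_pos hR hRS, hvS]
      · have : S ≠ R := fun h => hRS h.ge
        simp [triggered_of_neg hRS, hvS, this]
  rw [sum_congr rfl fun S _ => h1 S, sum_sub_distrib, sum_shapleyWeight]
  have hcard : Fintype.card V = R.card + 1 := by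
    rw [← card_univ, ← huniv, card_insert_of_notMem hv]
  simp only [sum_ite_eq', mem_univ, if_true]
  rw [hcard, shapleyWeight_self]
  field_simp
  ring

end CentralityMeasure

namespace CentralityMeasure

variable {ψ φ : CentralityMeasure.{u}} {V : Type u} [Fintype V] [DecidableEq V]

/-! ### Bayesian centralities are determined by trigger instances -/

/-- Bayesian Influence for an arbitrary finite index type and instances on arbitrary networks,
which is possible because centralities depend on the profile only. -/
theorem BayesianInfluence.mix (hψ : ψ.BayesianInfluence) {ι : Type*} [Fintype ι]
    (J : InfluenceInstance V) (I : ι → InfluenceInstance V) (lam : ι → ℝ) (h0 : ∀ i, 0 ≤ lam i)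
    (h1 : ∑ i, lam i = 1) (hP : ∀ S T, J.P S T = ∑ i, lam i * (I i).P S T) (v : V) :
    ψ.val V J v = ∑ i, lam i * ψ.val V (I i) v := by
  let e := Fintype.equivFin ι
  let K : Fin (Fintype.card ι) → InfluenceInstance V :=
    fun η => { I (e.symm η) with E := Set.univ }
  have hsum : ∑ η, lam (e.symm η) = 1 := by rw [e.symm.sum_comp lam, h1]
  have hJ : J.P = (bayes Set.univ K (fun η => lam (e.symm η)) (fun η => h0 _) hsum).P := by
    funext S T
    rw [hP]
    exact (e.symm.sum_comp fun i => lam i * (I i).P S T).symm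
  rw [ψ.of_profile V J _ hJ, hψ V Set.univ _ K _ _ _ (fun _ => rfl)]
  have hK : ∀ η, ψ.val V (K η) = ψ.val V (I (e.symm η)) := fun η => ψ.of_profile V _ _ rfl
  simp only [hK]
  exact e.symm.sum_comp fun i => lam i * ψ.val V (I i) v

/-- Up to multiples of the null profile, every profile is a nonnegative combination of the profiles
in which only one seed set `S` is active, activating a fixed set `T`; a Bayesian centrality
measure respects this decomposition. -/
theorem BayesianInfluence.expansion (hψ : ψ.BayesianInfluence) (I : InfluenceInstance V) (v : V) :
    ψ.val V I v + ((Fintype.card (Finset V) : ℝ) - 1) * ψ.val V (trigger (fun _ => False) ∅) v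
      = ∑ S, ∑ T, I.P S T * ψ.val V (trigger (· = S) T) v := by
  set N : InfluenceInstance V := trigger (fun _ => False) ∅ with hN
  set m : ℝ := (Fintype.card (Finset V) : ℝ) with hm
  have hm1 : 1 ≤ m := by
    rw [hm]
    exact_mod_cast Fintype.card_pos
  have hm0 : 0 < m := by linarith
  have hw : ∀ i : Fin 2, 0 ≤ (![1 / m, (m - 1) / m] : Fin 2 → ℝ) i := by
    have h1 : 0 ≤ 1 / m := by positivity
    have h2 : 0 ≤ (m - 1) / m := div_nonneg (by linarith) hm0.le
    intro i
    fin_cases i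
    · exact h1
    · exact h2
  have hw1 : ∑ i : Fin 2, (![1 / m, (m - 1) / m] : Fin 2 → ℝ) i = 1 := by
    simp only [Fin.sum_univ_two, Matrix.cons_val_zero, Matrix.cons_val_one]
    field_simp
    ring
  -- One instance, written as a mixture in two ways.
  let J := bayes Set.univ ![I, N] ![1 / m, (m - 1) / m] hw hw1
  have hJ : ∀ X Y, J.P X Y = 1 / m * I.P X Y + (m - 1) / m * N.P X Y := by
    intro X Y
    simp [J, bayes, Fin.sum_univ_two]
  have e1 := hψ.mix J ![I, N] ![1 / m, (m - 1) / m] hw hw1 (fun _ _ => rfl) v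
  have e2 := hψ.mix J (fun q : Finset V × Finset V => trigger (· = q.1) q.2)
    (fun q => I.P q.1 q.2 / m) (fun q => div_nonneg (I.nonneg _ _) hm0.le) ?_ ?_ v
  · rw [e1, Fin.sum_univ_two, Fintype.sum_prod_type] at e2
    simp only [Matrix.cons_val_zero, Matrix.cons_val_one] at e2
    have e3 : ∑ S, ∑ T, I.P S T / m * ψ.val V (trigger (· = S) T) v
        = (∑ S, ∑ T, I.P S T * ψ.val V (trigger (· = S) T) v) / m := by
      simp only [sum_div]
      exact sum_congr rfl fun S _ => sum_congr rfl fun T _ => by ring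
    rw [e3] at e2
    field_simp at e2
    linarith
  · rw [Fintype.sum_prod_type]
    simp only [← sum_div, I.sum_eq_one]
    rw [sum_const, card_univ, nsmul_eq_mul, ← hm]
    field_simp
  · intro X Y
    have key : ∀ S, ∑ T, I.P S T * (trigger (· = S) T).P X Y
        = N.P X Y + if S = X then I.P X Y - N.P X Y else 0 := by
      intro S
      split_ifs with hS
      · subst hS
        rcases S.eq_empty_or_nonempty with rfl | hne
        · have : ∀ T : Finset V, (trigger (· = (∅ : Finset V)) T).P ∅ Y = N.P ∅ Y := by
            intro T
            simp [hN, trigger_P, triggered]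
          simp only [this, ← sum_mul, I.sum_eq_one]
          by_cases hY : Y = ∅
          · simp [hY, I.empty_empty, N.empty_empty]
          · simp [I.empty_of_ne Y hY, N.empty_of_ne Y hY]
        · rw [sum_eq_single Y]
          · by_cases hSY : S ⊆ Y
            · simp [trigger_P, triggered, hne, union_eq_right.2 hSY]
            · simp [I.eq_zero_of_not_subset S Y hSY]
          · intro T _ hT
            by_cases hST : S ⊆ T
            · simp [trigger_P, triggered, hne, union_eq_right.2 hST, hT.symm]
            · simp [I.eq_zero_of_not_subset S T hST]
          · simp
      · have : ∀ T : Finset V, (trigger (· = S) T).P X Y = N.P X Y := by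
          intro T
          simp [hN, trigger_P, triggered, Ne.symm hS]
        simp only [this, ← sum_mul, I.sum_eq_one]
        ring
    rw [hJ, Fintype.sum_prod_type]
    have e3 : ∑ S, ∑ T, I.P S T / m * (trigger (· = S) T).P X Y
        = (∑ S, ∑ T, I.P S T * (trigger (· = S) T).P X Y) / m := by
      simp only [sum_div]
      exact sum_congr rfl fun S _ => sum_congr rfl fun T _ => by ring
    rw [e3, sum_congr rfl fun S _ => key S, sum_add_distrib]
    simp only [sum_const, card_univ, nsmul_eq_mul, ← hm, sum_ite_eq', mem_univ, if_true]
    field_simp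
    ring

/-- Two Bayesian centrality measures that agree on the null instance and on critical set instances
agree everywhere: the instances responding to a single seed set are recovered from the critical set
instances by downward induction on the seed set. -/
theorem BayesianInfluence.ext_of_critical (hψ : ψ.BayesianInfluence) (hφ : φ.BayesianInfluence)
    (v : V)
    (hnull : ψ.val V (trigger (fun _ => False) ∅) v = φ.val V (trigger (fun _ => False) ∅) v)
    (hcrit : ∀ R U : Finset V, R.Nonempty →
      ψ.val V (trigger (R ⊆ ·) U) v = φ.val V (trigger (R ⊆ ·) U) v)
    (I : InfluenceInstance V) : ψ.val V I v = φ.val V I v := by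
  let d : InfluenceInstance V → ℝ := fun I => ψ.val V I v - φ.val V I v
  have hd : ∀ I, d I = ∑ S, ∑ T, I.P S T * d (trigger (· = S) T) := by
    intro I
    have h1 := hψ.expansion I v
    have h2 := hφ.expansion I v
    rw [hnull] at h1
    simp only [d, mul_sub, sum_sub_distrib]
    linarith
  have hcongr : ∀ I J : InfluenceInstance V, I.P = J.P → d I = d J := by
    intro I J h
    simp only [d, ψ.of_profile V I J h, φ.of_profile V I J h]
  have hN : d (trigger (fun _ => False) ∅) = 0 := sub_eq_zero.2 hnull
  have hQ : ∀ R U : Finset V, d (trigger (· = R) U) = 0 := by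
    intro R
    induction R using WellFoundedGT.induction with
    | ind R ih =>
      intro U
      rcases R.eq_empty_or_nonempty with rfl | hR
      · rw [← hN]
        refine hcongr _ _ (trigger_P_congr fun X hX => ?_)
        simp [triggered, hX.ne_empty]
      have h : d (trigger (R ⊆ ·) U) = 0 := sub_eq_zero.2 (hcrit R U hR)
      rw [hd] at h
      simp only [sum_trigger] at h
      rw [sum_eq_single R] at h
      · rw [triggered_of_pos hR Subset.rfl] at h
        rw [← h]
        refine hcongr _ _ (trigger_P_congr fun X hX => ?_)
        by_cases hXR : X = R
        · simp [triggered, hXR]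
        · simp [triggered, hXR]
      · intro S _ hS
        by_cases hRS : R ⊆ S
        · exact ih S (lt_of_le_of_ne hRS hS.symm) _
        · rw [triggered_of_neg hRS, ← hN]
          refine hcongr _ _ (trigger_P_congr fun X hX => ?_)
          by_cases hXS : X = S <;> simp [triggered, hXS]
      · simp
  refine sub_eq_zero.1 (?_ : d I = 0)
  rw [hd]
  simp only [hQ, mul_zero, sum_const_zero]

/-! ### The axioms determine the centralities of critical set instances -/

theorem Anonymity.eq_of_permute (hψ : ψ.Anonymity) {I : InfluenceInstance V} {π : Equiv.Perm V}
    (h : (I.permute π).P = I.P) (v : V) : ψ.val V I (π v) = ψ.val V I v := by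
  rw [hψ V I π v, ψ.of_profile V _ _ h]

theorem val_null (hA : ψ.Anonymity) (hN : ψ.Normalization) (v : V) :
    ψ.val V (trigger (fun _ => False) ∅) v = 1 := by
  have h : ∀ w, ψ.val V (trigger (fun _ => False) ∅) w
      = ψ.val V (trigger (fun _ => False) ∅) v := by
    intro w
    have := hA.eq_of_permute (trigger_permute (p := fun _ => False) (U := ∅) (Equiv.swap v w)
      (fun _ => Iff.rfl) (map_empty _)) v
    rwa [Equiv.swap_apply_left] at this
  have h2 := hN V (trigger (fun _ => False) ∅)
  rw [sum_congr rfl fun w _ => h w, sum_const, card_univ, nsmul_eq_mul] at h2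
  have h3 : (Fintype.card V : ℝ) ≠ 0 := by
    exact_mod_cast (Fintype.card_pos_iff.2 ⟨v⟩).ne'
  exact mul_left_cancel₀ h3 (by rw [h2, mul_one])

/-- Outside the critical set all nodes are sinks, so projection removes all but one of them. -/
theorem val_critical_of_notMem
    (hA : ψ.Anonymity) (hN : ψ.Normalization) (hI : ψ.IndependenceOfSinkNodes)
    (hC : ψ.BargainingWithCriticalSets)
    (hA' : φ.Anonymity) (hN' : φ.Normalization) (hI' : φ.IndependenceOfSinkNodes)
    (hC' : φ.BargainingWithCriticalSets) (n : ℕ) :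
    ∀ (V : Type u) [Fintype V] [DecidableEq V] (R U : Finset V) (x : V), Fintype.card V = n →
      R.Nonempty → x ∉ R →
      ψ.val V (trigger (R ⊆ ·) U) x = φ.val V (trigger (R ⊆ ·) U) x := by
  induction n with
  | zero =>
    intro V _ _ _ _ x hV
    exact ((Fintype.card_eq_zero_iff.1 hV).false x).elim
  | succ n ih =>
    intro V _ _ R U x hV hR hx
    by_cases h : ∃ v, v ∉ R ∧ v ≠ x
    · obtain ⟨v, hv, hvx⟩ := h
      rw [hI V _ x v hvx.symm (trigger_isSink hR hx) (trigger_isSink hR hv),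
        hI' V _ x v hvx.symm (trigger_isSink hR hx) (trigger_isSink hR hv),
        ψ.of_profile _ _ _ (trigger_project hR hv), φ.of_profile _ _ _ (trigger_project hR hv)]
      refine ih _ _ _ _ ?_ ?_ (by simpa using hx)
      · rw [Fintype.card_subtype_compl, Fintype.card_subtype_eq, hV, Nat.add_sub_cancel]
      · obtain ⟨y, hy⟩ := hR
        exact ⟨⟨y, fun h => hv (h ▸ hy)⟩, by simpa using hy⟩
    · push Not at h
      have huniv : insert x R = univ := by
        refine eq_univ_iff_forall.2 fun v => mem_insert.2 ?_
        by_cases hv : v ∈ R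
        · exact Or.inr hv
        · exact Or.inl (h v hv)
      by_cases hxU : x ∈ U
      · have hP : (trigger (R ⊆ ·) U).P = (trigger (R ⊆ ·) (insert x R)).P := by
          refine trigger_P_congr fun X _ => ?_
          by_cases hRX : R ⊆ X
          · rw [triggered_of_pos hR hRX, triggered_of_pos hR hRX, huniv,
              union_eq_right.2 (subset_univ X), ← univ_subset_iff, ← huniv]
            exact insert_subset (mem_union_right _ hxU) (hRX.trans subset_union_left)
          · rw [triggered_of_neg hRX, triggered_of_neg hRX]
        have hcrit := trigger_isCriticalSet hR huniv
        rw [ψ.of_profile V _ _ hP, φ.of_profile V _ _ hP, hC V _ R x hx huniv hcrit,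
          hC' V _ R x hx huniv hcrit]
      · have hP : (trigger (R ⊆ ·) U).P = (trigger (fun _ => False) ∅).P := by
          refine trigger_P_congr fun X _ => ?_
          by_cases hRX : R ⊆ X
          · have hUX : U ⊆ X := fun y hy => hRX (by
              by_contra hyR
              exact hxU (h y hyR ▸ hy))
            rw [triggered_of_pos hR hRX, union_eq_left.2 hUX]
            simp [triggered]
          · rw [triggered_of_neg hRX]
            simp [triggered]
        rw [ψ.of_profile V _ _ hP, φ.of_profile V _ _ hP, val_null hA hN, val_null hA' hN']

/-- Inside the critical set, Anonymity and Normalization fix the centrality once it is known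
outside. -/
theorem val_critical_of_mem (hA : ψ.Anonymity) (hN : ψ.Normalization)
    (hA' : φ.Anonymity) (hN' : φ.Normalization) {R U : Finset V}
    (hout : ∀ y ∉ R, ψ.val V (trigger (R ⊆ ·) U) y = φ.val V (trigger (R ⊆ ·) U) y)
    {x : V} (hx : x ∈ R) :
    ψ.val V (trigger (R ⊆ ·) U) x = φ.val V (trigger (R ⊆ ·) U) x := by
  have hR : R.Nonempty := ⟨x, hx⟩
  -- The target set may be assumed to contain `R`, and is then invariant as well.
  have hP : (trigger (R ⊆ ·) U).P = (trigger (R ⊆ ·) (R ∪ U)).P := by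
    refine trigger_P_congr fun X _ => ?_
    by_cases hRX : R ⊆ X
    · rw [triggered_of_pos hR hRX, triggered_of_pos hR hRX, ← union_assoc, union_eq_left.2 hRX]
    · rw [triggered_of_neg hRX, triggered_of_neg hRX]
  have hmap : ∀ y ∈ R, ∀ W : Finset V, R ⊆ W → W.map (Equiv.swap x y).toEmbedding = W := by
    intro y hy W hRW
    refine eq_of_subset_of_card_le (fun z hz => ?_) (card_map _).ge
    obtain ⟨w, hw, rfl⟩ := mem_map.1 hz
    change Equiv.swap x y w ∈ W
    rw [Equiv.swap_apply_def]
    split_ifs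
    · exact hRW hy
    · exact hRW hx
    · exact hw
  have hsymm : ∀ χ : CentralityMeasure.{u}, χ.Anonymity → ∀ y ∈ R,
      χ.val V (trigger (R ⊆ ·) U) y = χ.val V (trigger (R ⊆ ·) U) x := by
    intro χ hχ y hy
    rw [χ.of_profile V _ _ hP]
    have := hχ.eq_of_permute (trigger_permute (p := (R ⊆ ·)) (U := R ∪ U) (Equiv.swap x y)
      (fun X => by rw [← map_subset_map (f := (Equiv.swap x y).toEmbedding) (s₁ := R) (s₂ := X),
        hmap y hy R Subset.rfl])
      (hmap y hy _ subset_union_left)) x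
    rwa [Equiv.swap_apply_left] at this
  have h1 := (hN V (trigger (R ⊆ ·) U)).trans (hN' V (trigger (R ⊆ ·) U)).symm
  rw [← sum_add_sum_compl R, ← sum_add_sum_compl R,
    sum_congr rfl (fun y hy => hout y (mem_compl.1 hy)), add_right_cancel_iff,
    sum_congr rfl (hsymm ψ hA), sum_congr rfl (hsymm φ hA'), sum_const, sum_const,
    nsmul_eq_mul, nsmul_eq_mul] at h1
  have h2 : (R.card : ℝ) ≠ 0 := by exact_mod_cast hR.card_pos.ne'
  exact mul_left_cancel₀ h2 h1

/-- The five axioms determine a centrality measure. -/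
theorem eq_of_axioms
    (hA : ψ.Anonymity) (hN : ψ.Normalization) (hI : ψ.IndependenceOfSinkNodes)
    (hB : ψ.BayesianInfluence) (hC : ψ.BargainingWithCriticalSets)
    (hA' : φ.Anonymity) (hN' : φ.Normalization) (hI' : φ.IndependenceOfSinkNodes)
    (hB' : φ.BayesianInfluence) (hC' : φ.BargainingWithCriticalSets) : ψ = φ := by
  refine CentralityMeasure.ext ?_
  funext V _ _ I v
  refine hB.ext_of_critical hB' v (by rw [val_null hA hN, val_null hA' hN']) (fun R U hR => ?_) I
  have hout := fun (y : V) (hy : y ∉ R) =>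
    val_critical_of_notMem hA hN hI hC hA' hN' hI' hC' _ V R U y rfl hR hy
  by_cases hv : v ∈ R
  · exact val_critical_of_mem hA hN hA' hN' hout hv
  · exact hout v hv

end CentralityMeasure

namespace CentralityMeasure

/-! ### Perturbations of the Shapley centrality -/

/-- The sum of two centrality measures. -/
instance : Add CentralityMeasure.{u} where
  add ψ c :=
    { val := fun V _ _ I v => ψ.val V I v + c.val V I v
      of_profile := fun V _ _ I J h => by
        funext v
        rw [ψ.of_profile V I J h, c.of_profile V I J h] }

theorem add_val (ψ c : CentralityMeasure.{u}) (V : Type u) [Fintype V] [DecidableEq V]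
    (I : InfluenceInstance V) (v : V) : (ψ + c).val V I v = ψ.val V I v + c.val V I v := rfl

/-- The centralities of all nodes add up to `0`. -/
def SumZero (c : CentralityMeasure.{u}) : Prop :=
  ∀ (V : Type u) [Fintype V] [DecidableEq V] (I : InfluenceInstance V), ∑ v, c.val V I v = 0

/-- Sinks have centrality `0`. -/
def VanishesAtSinks (c : CentralityMeasure.{u}) : Prop :=
  ∀ (V : Type u) [Fintype V] [DecidableEq V] (I : InfluenceInstance V) (v : V),
    I.IsSink v → c.val V I v = 0

variable {ψ c : CentralityMeasure.{u}}

theorem Anonymity.add (hψ : ψ.Anonymity) (hc : c.Anonymity) : (ψ + c).Anonymity := by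
  intro V _ _ I π v
  rw [add_val, add_val, ← hψ V I π v, ← hc V I π v]

theorem Normalization.add (hψ : ψ.Normalization) (hc : c.SumZero) : (ψ + c).Normalization := by
  intro V _ _ I
  simp only [add_val]
  rw [sum_add_distrib, hψ V I, hc V I, add_zero]

theorem BayesianInfluence.add (hψ : ψ.BayesianInfluence) (hc : c.BayesianInfluence) :
    (ψ + c).BayesianInfluence := by
  intro V _ _ E r I lam h0 h1 hE v
  simp only [add_val]
  rw [hψ V E r I lam h0 h1 hE v, hc V E r I lam h0 h1 hE v, ← sum_add_distrib]
  exact sum_congr rfl fun η _ => (mul_add _ _ _).symm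

theorem IndependenceOfSinkNodes.add (hψ : ψ.IndependenceOfSinkNodes) (hc : c.VanishesAtSinks) :
    (ψ + c).IndependenceOfSinkNodes := by
  intro V _ _ I x v hxv hx hv
  rw [add_val, add_val, ← hψ V I x v hxv hx hv, hc V I x hx, hc _ _ _ (hx.project hxv)]

theorem BargainingWithCriticalSets.add (hψ : ψ.BargainingWithCriticalSets)
    (hc : c.VanishesAtSinks) : (ψ + c).BargainingWithCriticalSets := by
  intro V _ _ I R v hv huniv hI
  rw [add_val, hψ V I R v hv huniv hI,
    hc V I v (isSink_congr hI.P_eq.symm (trigger_isSink hI.nonempty hv)), add_zero]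

/-! ### Without Anonymity -/

/-- The probability that the seed set `S` activates `z`. -/
def activationProb {V : Type u} [Fintype V] [DecidableEq V] (I : InfluenceInstance V) (z : V)
    (S : Finset V) : ℝ :=
  ∑ T, I.P S T * (if z ∈ T then 1 else 0)

/-- The excess of the probability that `a` and `b` together activate `z` over the sum of the
probabilities that each of them activates `z` alone. -/
def synergy {V : Type u} [Fintype V] [DecidableEq V] (I : InfluenceInstance V) (a b z : V) : ℝ :=
  activationProb I z {a, b} - activationProb I z {a} - activationProb I z {b}

section Synergy

variable {V : Type u} [Fintype V] [DecidableEq V] {I : InfluenceInstance V} {a b z : V}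

theorem activationProb_insert (h : I.IsSink a) {S : Finset V} (hS : a ∉ S) (hz : z ≠ a) :
    activationProb I z (insert a S) = activationProb I z S := by
  rw [activationProb, h.sum_insert hS, activationProb]
  simp [hz]

theorem activationProb_empty (I : InfluenceInstance V) (z : V) : activationProb I z ∅ = 0 := by
  refine sum_eq_zero fun T _ => ?_
  by_cases hT : T = ∅
  · simp [hT]
  · rw [I.empty_of_ne T hT, zero_mul]

theorem synergy_comm (I : InfluenceInstance V) (a b z : V) :
    synergy I a b z = synergy I b a z := by
  rw [synergy, synergy, pair_comm]
  ring

theorem synergy_eq_zero (h : I.IsSink a) (hab : a ≠ b) (hz : z ≠ a) : synergy I a b z = 0 := by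
  have h1 := activationProb_insert h (S := {b}) (by simpa using hab) hz
  have h2 := activationProb_insert h (notMem_empty a) hz
  rw [activationProb_empty] at h2
  change activationProb I z {a} = 0 at h2
  rw [synergy, h1, h2]
  ring

theorem synergy_bayes (E : Set (V × V)) {r : ℕ} (I : Fin r → InfluenceInstance V)
    (lam : Fin r → ℝ) (h0 : ∀ η, 0 ≤ lam η) (h1 : ∑ η, lam η = 1) (a b z : V) :
    synergy (bayes E I lam h0 h1) a b z = ∑ η, lam η * synergy (I η) a b z := by
  simp only [synergy, activationProb, sum_bayes, mul_sub, sum_sub_distrib]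

end Synergy

open Classical in
/-- On every node set with at least three elements, choose three of them, `a`, `b` and `z`, and
transfer the synergy of `a` and `b` in activating `z` from `b` to `a`. -/
noncomputable def synergyTransfer : CentralityMeasure.{u} where
  val := fun V _ _ I v =>
    if h : Nonempty (Fin 3 ↪ V) then
      synergy I (h.some 0) (h.some 1) (h.some 2)
        * ((if v = h.some 0 then 1 else 0) - (if v = h.some 1 then 1 else 0))
    else 0
  of_profile := fun V _ _ I J h => by
    simp only [synergy, activationProb, h]

section

variable {V : Type u} [Fintype V] [DecidableEq V]

theorem synergyTransfer_of_nonempty (h : Nonempty (Fin 3 ↪ V)) (I : InfluenceInstance V) (v : V) :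
    synergyTransfer.val V I v = synergy I (h.some 0) (h.some 1) (h.some 2)
      * ((if v = h.some 0 then 1 else 0) - (if v = h.some 1 then 1 else 0)) := by
  simp only [synergyTransfer, dif_pos h]

theorem synergyTransfer_of_not (h : ¬ Nonempty (Fin 3 ↪ V)) (I : InfluenceInstance V) (v : V) :
    synergyTransfer.val V I v = 0 :=
  dif_neg h

end

theorem synergyTransfer_sumZero : synergyTransfer.{u}.SumZero := by
  intro V _ _ I
  by_cases h : Nonempty (Fin 3 ↪ V)
  · simp only [synergyTransfer_of_nonempty h]
    rw [← mul_sum, sum_sub_distrib]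
    simp
  · simp only [synergyTransfer_of_not h, sum_const_zero]

theorem synergyTransfer_vanishesAtSinks : synergyTransfer.{u}.VanishesAtSinks := by
  intro V _ _ I v hv
  by_cases h : Nonempty (Fin 3 ↪ V)
  · rw [synergyTransfer_of_nonempty h]
    have h01 : h.some 0 ≠ h.some 1 := h.some.injective.ne (by decide)
    have h20 : h.some 2 ≠ h.some 0 := h.some.injective.ne (by decide)
    have h21 : h.some 2 ≠ h.some 1 := h.some.injective.ne (by decide)
    by_cases h0 : v = h.some 0
    · rw [synergy_eq_zero (h0 ▸ hv) h01 h20, zero_mul]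
    · by_cases h1 : v = h.some 1
      · rw [synergy_comm, synergy_eq_zero (h1 ▸ hv) h01.symm h21, zero_mul]
      · simp [h0, h1]
  · exact synergyTransfer_of_not h I v

theorem synergyTransfer_bayesianInfluence : synergyTransfer.{u}.BayesianInfluence := by
  intro V _ _ E r I lam h0 h1 _ v
  by_cases h : Nonempty (Fin 3 ↪ V)
  · simp only [synergyTransfer_of_nonempty h, synergy_bayes, sum_mul, mul_assoc]
  · simp only [synergyTransfer_of_not h, mul_zero, sum_const_zero]

/-- If only the seed sets containing `a` and `b` have influence, the Shapley centrality treats `a`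
and `b` alike, but the transfer does not. -/
theorem not_anonymity : ¬ (shapleyCentrality + synergyTransfer.{u}).Anonymity := by
  intro hA
  let V := ULift.{u} (Fin 3)
  have h : Nonempty (Fin 3 ↪ V) := ⟨Equiv.ulift.symm.toEmbedding⟩
  set a := h.some 0 with ha
  set b := h.some 1 with hb
  set z := h.some 2 with hz
  have hab : a ≠ b := h.some.injective.ne (by decide)
  have hza : z ≠ a := h.some.injective.ne (by decide)
  have hzb : z ≠ b := h.some.injective.ne (by decide)
  let I : InfluenceInstance V := trigger ({a, b} ⊆ ·) univ
  have hP : (I.permute (Equiv.swap a b)).P = I.P := by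
    refine trigger_permute _ (fun X => ?_) (map_univ_equiv _)
    simp only [insert_subset_iff, singleton_subset_iff, mem_map_equiv, Equiv.symm_swap,
      Equiv.swap_apply_left, Equiv.swap_apply_right]
    exact and_comm
  have e1 := hA.eq_of_permute hP a
  have e2 := shapley_anonymity.eq_of_permute hP a
  rw [Equiv.swap_apply_left] at e1 e2
  rw [add_val, add_val, e2, add_right_inj, synergyTransfer_of_nonempty h,
    synergyTransfer_of_nonempty h] at e1
  rw [← ha, ← hb, ← hz, if_neg hab.symm, if_pos rfl, if_pos rfl, if_neg hab] at e1
  have hs : synergy I a b z = 1 := by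
    have n1 : ¬ ({a, b} : Finset V) ⊆ {a} := fun h => hab.symm (by
      simpa using h (mem_insert_of_mem (mem_singleton_self b)))
    have n2 : ¬ ({a, b} : Finset V) ⊆ {b} := fun h => hab (by
      simpa using h (mem_insert_self a {b}))
    simp only [synergy, activationProb, I, sum_trigger]
    rw [triggered_of_pos (insert_nonempty a {b}) Subset.rfl, triggered_of_neg n1,
      triggered_of_neg n2]
    simp [hza, hzb]
  rw [hs] at e1
  norm_num at e1

/-! ### Without Normalization -/

/-- The expected number of nodes other than `v` that `v` activates on its own. -/
def soloSpread : CentralityMeasure.{u} where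
  val := fun _ _ _ I v => I.spread {v} - 1
  of_profile := fun V _ _ I J h => by
    funext v
    simp only [spread, h]

theorem soloSpread_anonymity : soloSpread.{u}.Anonymity := by
  intro V _ _ I π v
  have := spread_permute π I {v}
  rw [map_singleton] at this
  exact congrArg (· - 1) this.symm

theorem soloSpread_vanishesAtSinks : soloSpread.{u}.VanishesAtSinks := fun _ _ _ _ _ hv =>
  sub_eq_zero.2 hv.spread_singleton

theorem soloSpread_bayesianInfluence : soloSpread.{u}.BayesianInfluence := by
  intro V _ _ E r I lam h0 h1 _ v
  change (bayes E I lam h0 h1).spread {v} - 1 = ∑ η, lam η * ((I η).spread {v} - 1)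
  simp only [spread_eq_sum, sum_bayes, mul_sub, sum_sub_distrib, mul_one, h1]

theorem not_normalization : ¬ (shapleyCentrality + soloSpread.{u}).Normalization := by
  intro hN
  let V := ULift.{u} (Fin 2)
  let I : InfluenceInstance V := trigger (fun _ => True) univ
  have h1 := hN V I
  simp only [add_val] at h1
  rw [sum_add_distrib, shapley_normalization V I] at h1
  have h2 : ∀ v : V, soloSpread.val V I v = 1 := by
    intro v
    change I.spread {v} - 1 = 1
    rw [spread_eq_sum, sum_trigger, triggered, if_pos ⟨singleton_nonempty v, trivial⟩,
      union_eq_right.2 (subset_univ _), card_univ]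
    simp only [V, Fintype.card_ulift, Fintype.card_fin]
    norm_num
  simp [h2, V] at h1

/-! ### Without Independence of Sink Nodes -/

section SoloExcess

variable {V : Type u} [Fintype V] [DecidableEq V]

/-- `|V|` times the excess over the average of the probability that `v` alone activates every
node. -/
def soloExcess (I : InfluenceInstance V) (v : V) : ℝ :=
  (Fintype.card V : ℝ) * I.P {v} univ - ∑ w, I.P {w} univ

theorem sum_soloExcess (I : InfluenceInstance V) : ∑ v, soloExcess I v = 0 := by
  simp only [soloExcess]
  rw [sum_sub_distrib, ← mul_sum, sum_const, card_univ, nsmul_eq_mul, sub_self]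

theorem soloExcess_permute (π : Equiv.Perm V) (I : InfluenceInstance V) (v : V) :
    soloExcess (I.permute π) (π v) = soloExcess I v := by
  rw [soloExcess, soloExcess, permute_P_singleton_univ, ← Equiv.sum_comp π]
  simp only [permute_P_singleton_univ]

theorem soloExcess_bayes (E : Set (V × V)) {r : ℕ} (I : Fin r → InfluenceInstance V)
    (lam : Fin r → ℝ) (h0 : ∀ η, 0 ≤ lam η) (h1 : ∑ η, lam η = 1) (v : V) :
    soloExcess (bayes E I lam h0 h1) v = ∑ η, lam η * soloExcess (I η) v := by
  simp only [soloExcess, bayes, mul_sub, sum_sub_distrib, mul_sum]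
  rw [sum_comm]
  congr 1
  exact sum_congr rfl fun η _ => by ring

end SoloExcess

/-- The factor `|V| - 2` makes this vanish for `|V| = 2`. For `|V| > 2` it vanishes in the
critical set instances on `V = R ∪ {v}`, where no single node activates all others, but not in all
those with a single critical node. -/
def scaledExcess : CentralityMeasure.{u} where
  val := fun V _ _ I v => ((Fintype.card V : ℝ) - 2) * soloExcess I v
  of_profile := fun V _ _ I J h => by
    simp only [soloExcess, h]

theorem scaledExcess_anonymity : scaledExcess.{u}.Anonymity := fun V _ _ I π v =>
  congrArg (((Fintype.card V : ℝ) - 2) * ·) (soloExcess_permute π I v).symm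

theorem scaledExcess_sumZero : scaledExcess.{u}.SumZero := by
  intro V _ _ I
  change ∑ v, ((Fintype.card V : ℝ) - 2) * soloExcess I v = 0
  rw [← mul_sum, sum_soloExcess, mul_zero]

theorem scaledExcess_bayesianInfluence : scaledExcess.{u}.BayesianInfluence := by
  intro V _ _ E r I lam h0 h1 _ v
  simp only [scaledExcess, soloExcess_bayes, mul_sum]
  exact sum_congr rfl fun η _ => by ring

theorem bargaining_scaledExcess :
    (shapleyCentrality + scaledExcess.{u}).BargainingWithCriticalSets := by
  intro V _ _ I R v hv huniv hI
  rw [add_val, shapley_bargainingWithCriticalSets V I R v hv huniv hI]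
  have hcard : Fintype.card V = R.card + 1 := by
    rw [← card_univ, ← huniv, card_insert_of_notMem hv]
  suffices h : scaledExcess.val V I v = 0 by rw [h, add_zero]
  change ((Fintype.card V : ℝ) - 2) * soloExcess I v = 0
  by_cases h1 : R.card = 1
  · rw [hcard, h1]
    norm_num
  · have h2 : 2 ≤ R.card := by
      have := hI.nonempty.card_pos
      omega
    have h3 : ∀ w, I.P {w} univ = 0 := by
      intro w
      have hRw : ¬ R ⊆ {w} := fun h => by
        have := card_le_card h
        rw [card_singleton] at this
        omega
      rw [I.P_eq_ite (hI.inert _ hRw), if_neg]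
      intro h
      have := congrArg card h
      rw [card_univ, hcard, card_singleton] at this
      omega
    simp [soloExcess, h3]

/-- On three nodes, of which a single one activates all, the other two are sinks with
negative excess; projection to two nodes removes it. -/
theorem not_independenceOfSinkNodes :
    ¬ (shapleyCentrality + scaledExcess.{u}).IndependenceOfSinkNodes := by
  intro hS
  let V := ULift.{u} (Fin 3)
  let a : V := ⟨0⟩
  let x : V := ⟨1⟩
  let v : V := ⟨2⟩
  have hxa : x ∉ ({a} : Finset V) := by decide
  have hva : v ∉ ({a} : Finset V) := by decide
  have hxv : x ≠ v := by decide
  let I : InfluenceInstance V := trigger ({a} ⊆ ·) univ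
  have hx : I.IsSink x := trigger_isSink (singleton_nonempty a) hxa
  have hv : I.IsSink v := trigger_isSink (singleton_nonempty a) hva
  have h1 := hS V I x v hxv hx hv
  rw [add_val, add_val, ← shapley_independenceOfSinkNodes V I x v hxv hx hv, add_right_inj] at h1
  have hcV : Fintype.card V = 3 := by simp [V]
  have hcW : Fintype.card {y : V // y ≠ v} = 2 := by
    rw [Fintype.card_subtype_compl, Fintype.card_subtype_eq, hcV]
  have hp : ∀ w : V, I.P {w} univ = if w = a then 1 else 0 := by
    intro w
    have hone : (univ : Finset V) ≠ {w} := fun h => by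
      have := congrArg card h
      rw [card_univ, hcV, card_singleton] at this
      omega
    by_cases hw : w = a
    · rw [if_pos hw, trigger_P, triggered_of_pos (singleton_nonempty a) (by simp [hw]),
        union_eq_right.2 (subset_univ _), if_pos rfl]
    · rw [if_neg hw, trigger_P, triggered_of_neg (by simpa using Ne.symm hw), if_neg hone]
  have hx' : x ≠ a := by decide
  simp only [scaledExcess, hcW, soloExcess, hp, hcV, hx', sum_ite_eq', mem_univ, if_true,
    if_false] at h1
  norm_num at h1

/-! ### Without Bayesian Influence -/

/-- The factor in front of the excess vanishes as soon as there is a sink, but makes the measure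
nonlinear in the profile. -/
def productExcess : CentralityMeasure.{u} where
  val := fun _ _ _ I v => (∏ w, I.P {w} univ) * soloExcess I v
  of_profile := fun V _ _ I J h => by
    simp only [soloExcess, h]

theorem productExcess_anonymity : productExcess.{u}.Anonymity := by
  intro V _ _ I π v
  change (∏ w, I.P {w} univ) * soloExcess I v
    = (∏ w, (I.permute π).P {w} univ) * soloExcess (I.permute π) (π v)
  rw [soloExcess_permute, ← Equiv.prod_comp π (fun w => (I.permute π).P {w} univ)]
  simp only [permute_P_singleton_univ]

theorem productExcess_sumZero : productExcess.{u}.SumZero := by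
  intro V _ _ I
  change ∑ v, (∏ w, I.P {w} univ) * soloExcess I v = 0
  rw [← mul_sum, sum_soloExcess, mul_zero]

theorem productExcess_vanishesAtSinks : productExcess.{u}.VanishesAtSinks := by
  intro V _ _ I v hv
  change (∏ w, I.P {w} univ) * soloExcess I v = 0
  by_cases h : (univ.erase v).Nonempty
  · have h1 := hv ∅ (univ.erase v) (notMem_empty v) (notMem_erase v _)
    rw [insert_erase (mem_univ v), I.empty_of_ne _ h.ne_empty,
      I.empty_of_ne univ (ne_empty_of_mem (mem_univ v)), add_zero] at h1
    change I.P {v} univ = 0 at h1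
    rw [prod_eq_zero (mem_univ v) h1, zero_mul]
  · -- The excess of the only node of a one-node instance is `0`.
    have huniv : (univ : Finset V) = {v} := by
      rw [← insert_erase (mem_univ v), not_nonempty_iff_eq_empty.1 h, insert_empty_eq]
    have h1 := sum_soloExcess I
    rw [huniv, sum_singleton] at h1
    rw [h1, mul_zero]

/-- On two nodes, mix the instance in which each node activates the other with the one in which
only the first does. The excess is `0` in the former and the product is `0` in the latter, but in
the mixture neither is. -/
theorem not_bayesianInfluence : ¬ (shapleyCentrality + productExcess.{u}).BayesianInfluence := by
  intro hB
  let V := ULift.{u} (Fin 2)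
  let a : V := ⟨0⟩
  let b : V := ⟨1⟩
  have huniv : (univ : Finset V) = {a, b} := by decide
  have hab : a ≠ b := by decide
  have hcV : Fintype.card V = 2 := by simp [V]
  let I : Fin 2 → InfluenceInstance V := ![trigger (fun _ => True) univ, trigger (a ∈ ·) univ]
  have hE : ∀ η, (I η).E = Set.univ := by
    intro η
    fin_cases η <;> rfl
  have hlam : ∀ η : Fin 2, (0 : ℝ) ≤ (fun _ => 1 / 2) η := fun _ => by norm_num
  have hsum : ∑ η : Fin 2, (fun _ => (1 / 2 : ℝ)) η = 1 := by simp
  have h1 := hB V Set.univ 2 I (fun _ => 1 / 2) hlam hsum hE a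
  have h2 := shapley_bayesianInfluence V Set.univ 2 I (fun _ => 1 / 2) hlam hsum hE a
  simp only [add_val, mul_add, sum_add_distrib] at h1
  rw [h2, add_right_inj] at h1
  have hba : ({b} : Finset V) ≠ univ := by decide
  have haU : ({a} : Finset V) ∪ univ = univ := union_eq_right.2 (subset_univ _)
  have hbU : ({b} : Finset V) ∪ univ = univ := union_eq_right.2 (subset_univ _)
  have p0a : (I 0).P {a} univ = 1 := by simp [I, trigger_P, triggered, haU]
  have p0b : (I 0).P {b} univ = 1 := by simp [I, trigger_P, triggered, hbU]
  have p1a : (I 1).P {a} univ = 1 := by simp [I, trigger_P, triggered, haU]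
  have p1b : (I 1).P {b} univ = 0 := by simp [I, trigger_P, triggered, hab, hba.symm]
  have q : ∀ w, (bayes Set.univ I (fun _ => 1 / 2) hlam hsum).P {w} univ
      = 1 / 2 * (I 0).P {w} univ + 1 / 2 * (I 1).P {w} univ := by
    intro w
    simp [bayes, Fin.sum_univ_two]
  have hprod : ∀ f : V → ℝ, ∏ w, f w = f a * f b := fun f => by rw [huniv, prod_pair hab]
  have hsum' : ∀ f : V → ℝ, ∑ w, f w = f a + f b := fun f => by rw [huniv, sum_pair hab]
  simp only [productExcess, soloExcess, hprod, hsum', q, Fin.sum_univ_two, p0a, p0b, p1a, p1b,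
    hcV] at h1
  norm_num at h1

/-! ### Without Bargaining with Critical Sets -/

/-- The centrality measure that gives every node of every instance the value `1`. -/
def uniform : CentralityMeasure.{u} where
  val := fun _ _ _ _ _ => 1
  of_profile := fun _ _ _ _ _ _ => rfl

theorem uniform_normalization : uniform.{u}.Normalization := by
  intro V _ _ I
  simp [uniform]

theorem uniform_bayesianInfluence : uniform.{u}.BayesianInfluence := by
  intro V _ _ E r I lam h0 h1 _ v
  simp [uniform, h1]

theorem not_bargaining_uniform : ¬ uniform.{u}.BargainingWithCriticalSets := by
  intro hC
  let V := ULift.{u} (Fin 2)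
  let a : V := ⟨0⟩
  let b : V := ⟨1⟩
  have hb : b ∉ ({a} : Finset V) := by decide
  have huniv : insert b ({a} : Finset V) = univ := by decide
  have h := hC V _ {a} b hb huniv (trigger_isCriticalSet (singleton_nonempty a) huniv)
  rw [card_singleton] at h
  norm_num [uniform] at h

end CentralityMeasure

theorem theorem1 :
    (∀ ψ : CentralityMeasure.{u},
      (ψ.Anonymity ∧ ψ.Normalization ∧ ψ.IndependenceOfSinkNodes ∧ ψ.BayesianInfluence ∧
        ψ.BargainingWithCriticalSets) ↔ ψ = shapleyCentrality.{u}) ∧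
    (∃ ψ : CentralityMeasure.{u},
      ¬ ψ.Anonymity ∧ ψ.Normalization ∧ ψ.IndependenceOfSinkNodes ∧ ψ.BayesianInfluence ∧
        ψ.BargainingWithCriticalSets) ∧
    (∃ ψ : CentralityMeasure.{u},
      ψ.Anonymity ∧ ¬ ψ.Normalization ∧ ψ.IndependenceOfSinkNodes ∧ ψ.BayesianInfluence ∧
        ψ.BargainingWithCriticalSets) ∧
    (∃ ψ : CentralityMeasure.{u},
      ψ.Anonymity ∧ ψ.Normalization ∧ ¬ ψ.IndependenceOfSinkNodes ∧ ψ.BayesianInfluence ∧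
        ψ.BargainingWithCriticalSets) ∧
    (∃ ψ : CentralityMeasure.{u},
      ψ.Anonymity ∧ ψ.Normalization ∧ ψ.IndependenceOfSinkNodes ∧ ¬ ψ.BayesianInfluence ∧
        ψ.BargainingWithCriticalSets) ∧
    (∃ ψ : CentralityMeasure.{u},
      ψ.Anonymity ∧ ψ.Normalization ∧ ψ.IndependenceOfSinkNodes ∧ ψ.BayesianInfluence ∧
        ¬ ψ.BargainingWithCriticalSets) := by
  open CentralityMeasure in
  refine ⟨fun ψ => ⟨?_, ?_⟩,
    ⟨shapleyCentrality + synergyTransfer, not_anonymity,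
      shapley_normalization.add synergyTransfer_sumZero,
      shapley_independenceOfSinkNodes.add synergyTransfer_vanishesAtSinks,
      shapley_bayesianInfluence.add synergyTransfer_bayesianInfluence,
      shapley_bargainingWithCriticalSets.add synergyTransfer_vanishesAtSinks⟩,
    ⟨shapleyCentrality + soloSpread, shapley_anonymity.add soloSpread_anonymity,
      not_normalization,
      shapley_independenceOfSinkNodes.add soloSpread_vanishesAtSinks,
      shapley_bayesianInfluence.add soloSpread_bayesianInfluence,
      shapley_bargainingWithCriticalSets.add soloSpread_vanishesAtSinks⟩,
    ⟨shapleyCentrality + scaledExcess, shapley_anonymity.add scaledExcess_anonymity,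
      shapley_normalization.add scaledExcess_sumZero,
      not_independenceOfSinkNodes,
      shapley_bayesianInfluence.add scaledExcess_bayesianInfluence,
      bargaining_scaledExcess⟩,
    ⟨shapleyCentrality + productExcess, shapley_anonymity.add productExcess_anonymity,
      shapley_normalization.add productExcess_sumZero,
      shapley_independenceOfSinkNodes.add productExcess_vanishesAtSinks,
      not_bayesianInfluence,
      shapley_bargainingWithCriticalSets.add productExcess_vanishesAtSinks⟩,
    ⟨uniform, fun _ _ _ _ _ _ => rfl, uniform_normalization, fun _ _ _ _ _ _ _ _ _ => rfl,
      uniform_bayesianInfluence, not_bargaining_uniform⟩⟩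
  · rintro ⟨hA, hN, hI, hB, hC⟩
    exact eq_of_axioms hA hN hI hB hC shapley_anonymity shapley_normalization
      shapley_independenceOfSinkNodes shapley_bayesianInfluence shapley_bargainingWithCriticalSets
  · rintro rfl
    exact ⟨shapley_anonymity, shapley_normalization, shapley_independenceOfSinkNodes,
      shapley_bayesianInfluence, shapley_bargainingWithCriticalSets⟩
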